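/- Let $R$ be an integral domain, let $G$ be a finite abelian group, and suppose that $R$ contains a primitive $8|G|$-th root of unity. Let $\mathcal C$ be a near-group category over $R$ with underlying group $G$; that is, $\mathcal C$ is an $R$-linear monoidal category with finite direct sums and $R$-bilinear tensor product, with the following properties. - $\mathcal C$ is semisimple, and its simple objects are represented, without repetition, by the elements $g$ of $G$ and one further object $m$: the endomorphism ring of each of these objects is $R$, there are no nonzero morphisms between two different ones, and every object is isomorphic to a finite direct sum of them. - The objects $g\in G$ multiply as in the group: the identity element of $G$ represents the unit object, and $g\otimes h\cong gh$ for all $g,h\in G$. In particular they are invertible. - $m$ is not invertible, it is self-dual and it is not a summand of $m\otimes m$; explicitly, $m\otimes m\cong\bigoplus_{g\in G}g$. (It follows that $g\otimes m\cong m\cong m\otimes g$.) Let $\beta$ be any braiding of $\mathcal C$. Then: (1) The braiding is symmetric on the subcategory generated by the invertible objects: if $X$ and $Y$ are finite direct sums of invertible objects, then $\beta_{Y,X}\circ\beta_{X,Y}=\mathrm{id}_{X\otimes Y}$. (2) One can choose isomorphisms $gh\to g\otimes h$, $m\to g\otimes m$ and $m\to m\otimes g$ for all $g,h\in G$, and an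 isomorphism $\bigoplus_{g\in G}g\to m\otimes m$, such that, with respect to this choice of basis, each commuting isomorphism $g\otimes h\to h\otimes g$, $g\otimes m\to m\otimes g$ and $m\otimes g\to g\otimes m$ is multiplication by an element $\sigma_0(g,h)$, $\sigma_1(g)$, $\sigma_2(g)$ of $R$, respectively, the commuting isomorphism $m\otimes m\to m\otimes m$ is multiplication by an element $\sigma_3(g)$ of $R$ on the summand $g$ for each $g\in G$, and all these elements are $8|G|$-th roots of unity. -/

import Mathlib

open CategoryTheory CategoryTheory.Limits CategoryTheory.MonoidalCategory

universe w x v u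

namespace NearGroup

/-- An object is invertible if it has a two-sided inverse for the tensor product, up to
isomorphism. -/
def IsInvertible {C : Type u} [Category.{v} C] [MonoidalCategory C] (X : C) : Prop :=
  ∃ Y : C, Nonempty (X ⊗ Y ≅ 𝟙_ C) ∧ Nonempty (Y ⊗ X ≅ 𝟙_ C)

/-- `C` is a semisimple `R`-linear category whose simple objects are represented, without
repetition, by the family `S`. The ground ring `R` need not be a field, so "simple" is meant in
the additive sense: the endomorphism ring of a simple object is `R`, there are no nonzero
morphisms between different simple objects, and every object is a finite direct sum of them. -/
structure IsSemisimple (R : Type w) [CommRing R] {C : Type u} [Category.{v} C] [Preadditive C]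
    [Linear R C] [HasFiniteBiproducts C] {I : Type x} (S : I → C) : Prop where
  end_bijective : ∀ i, Function.Bijective (fun r : R => r • 𝟙 (S i))
  hom_eq_zero : ∀ i j, i ≠ j → ∀ f : S i ⟶ S j, f = 0
  decomposition : ∀ X : C, ∃ (n : ℕ) (d : Fin n → I), Nonempty (X ≅ ⨁ fun k => S (d k))

/-- `C` is a near-group category over `R` with underlying group `G`, whose simple objects are
represented by the objects `obj g` for `g : G` and by one further object `m`:

* `C` is semisimple with these simple objects (`none` is the index of `m`);
* the `obj g` multiply as the elements of `G` do, in particular they are invertible;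
* `m` is not invertible;
* `m` is self-dual and is not a summand of `m ⊗ m`, in the sense of the fusion rule that
  `m ⊗ m` is the direct sum of all the `obj g`, each taken once.

(That `obj g ⊗ m` and `m ⊗ obj g` are isomorphic to `m` is a consequence.) -/
structure IsNearGroupCategory (R : Type w) [CommRing R] {G : Type x} [Group G] [Finite G]
    {C : Type u} [Category.{v} C] [Preadditive C] [Linear R C] [HasFiniteBiproducts C]
    [MonoidalCategory C] (obj : G → C) (m : C) : Prop where
  semisimple : IsSemisimple R (fun i : Option G => i.elim m obj)
  unit_iso : Nonempty (obj 1 ≅ 𝟙_ C)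
  mul_iso : ∀ g h : G, Nonempty (obj (g * h) ≅ obj g ⊗ obj h)
  not_invertible : ¬ IsInvertible m
  fusion : Nonempty ((⨁ obj) ≅ m ⊗ m)

/-- The objects of the subcategory generated by the invertible objects: the finite direct sums
of invertible objects. -/
def groupSubcategory (C : Type u) [Category.{v} C] [Preadditive C] [HasFiniteBiproducts C]
    [MonoidalCategory C] : ObjectProperty C :=
  fun X => ∃ (n : ℕ) (d : Fin n → C), (∀ k, IsInvertible (d k)) ∧ Nonempty (X ≅ ⨁ d)

/-- A choice of basis for the products of simple objects: a basis vector in each of the rank one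
modules `Hom(gh, g ⊗ h)`, `Hom(m, g ⊗ m)`, `Hom(m, m ⊗ g)` (the basis vectors of such a module are
the isomorphisms in it) and a basis vector in each `Hom(g, m ⊗ m)`, which together are an
identification of `m ⊗ m` with the direct sum of the `g`. -/
structure ProductBasis {G : Type x} [Group G] [Finite G] {C : Type u} [Category.{v} C]
    [Preadditive C] [HasFiniteBiproducts C] [MonoidalCategory C] (obj : G → C) (m : C) where
  groupGroup : ∀ g h : G, obj (g * h) ≅ obj g ⊗ obj h
  groupM : ∀ g : G, m ≅ obj g ⊗ m
  mGroup : ∀ g : G, m ≅ m ⊗ obj g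
  mM : (⨁ obj) ≅ m ⊗ m

/-- The basis vector of `Hom(g, m ⊗ m)`, that is, the inclusion of the summand `g`. -/
noncomputable def ProductBasis.summand {G : Type x} [Group G] [Finite G] {C : Type u}
    [Category.{v} C] [Preadditive C] [HasFiniteBiproducts C] [MonoidalCategory C] {obj : G → C}
    {m : C} (B : ProductBasis obj m) (g : G) : obj g ⟶ m ⊗ m :=
  biproduct.ι obj g ≫ B.mM.hom

/-- With respect to the basis `B`, the commuting isomorphism `gh ⟶ hg` is multiplication by
`σ₀ g h`, the one `gm ⟶ mg` by `σ₁ g`, the one `mg ⟶ gm` by `σ₂ g`, and the one `mm ⟶ mm` by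
`σ₃ g` on the summand `g`. -/
structure ProductBasis.IsCommutativity {R : Type w} [CommRing R] {G : Type x} [CommGroup G]
    [Finite G] {C : Type u} [Category.{v} C] [Preadditive C] [Linear R C]
    [HasFiniteBiproducts C] [MonoidalCategory C] [BraidedCategory C] {obj : G → C} {m : C}
    (B : ProductBasis obj m) (σ₀ : G → G → R) (σ₁ σ₂ σ₃ : G → R) : Prop where
  groupGroup : ∀ g h : G, (B.groupGroup g h).hom ≫ (β_ (obj g) (obj h)).hom =
    σ₀ g h • (eqToHom (congrArg obj (mul_comm g h)) ≫ (B.groupGroup h g).hom)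
  groupM : ∀ g : G, (B.groupM g).hom ≫ (β_ (obj g) m).hom = σ₁ g • (B.mGroup g).hom
  mGroup : ∀ g : G, (B.mGroup g).hom ≫ (β_ m (obj g)).hom = σ₂ g • (B.groupM g).hom
  mM : ∀ g : G, B.summand g ≫ (β_ m m).hom = σ₃ g • B.summand g

end NearGroup

/-!
The isomorphisms `g ⊗ h ≅ gh` and `g ⊗ m ≅ m` can be rescaled, so what has to be controlled are the
invariants that do not depend on a basis: the monodromy (double braiding) of `g` with `h` and with
`m`, and the scalar `σ₃ g` by which the braiding of `m ⊗ m` acts on the summand `g`.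

*Monodromy.* Over a domain, an object with endomorphism ring `R` is isomorphic to a simple one
(`IsSemisimple.exists_iso`), so `g ⊗ m ≅ m` and the monodromy of `g` with `m` is a scalar `q g`.
Monodromy with a fixed invertible object is natural and multiplicative, so on every summand of
`m ⊗ m` it is `q g ^ 2`. One of the summands is the unit object, so `q g ^ 2 = 1` and the
monodromy of two group objects is trivial (`exists_monodromy`).

*Twists.* Let `b` and `d` be the automorphisms of `(m ⊗ m) ⊗ m` which rotate the last factor to the
front and braid the first two factors, and let `k` be the monodromy of `m ⊗ m` with `m`. The
hexagons give `b ^ 2 = d b d` and `b ^ 3 = d ^ 2 k` (`rotate_rotate`, `rotate_cube`). On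
`Hom(m, (m ⊗ m) ⊗ m)`, which is free with a basis indexed by `G`, the operators `d` and `k` are
diagonal with entries `σ₃ g` and `q g`. Determinants give `(∏ g, σ₃ g) ^ 8 = 1`
(`prod_twist_pow`). Moreover `b` commutes with the diagonal operator `d ^ 2 k`. The pentagon
identity shows that tensoring with `g` permutes the coefficients of `b` in the column of `1` up to
units, so none of them vanishes (`coeff_ne_zero`); therefore `σ₃ g ^ 2 * q g` does not depend on `g`
(`twist_sq_mul`). So all `σ₃ g` have the same fourth power, and the determinant relation becomes
`σ₃ g ^ (8 * |G|) = 1` (`twist_pow`).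
-/

namespace NearGroup

/-! ### Objects with scalar endomorphisms -/

section Scalar

variable (R : Type w) [CommRing R] {C : Type u} [Category.{v} C] [Preadditive C] [Linear R C]

/-- The endomorphism ring of `X` is the ground ring: this is what replaces Schur's lemma for the
simple objects. -/
def HasScalarEnd (X : C) : Prop :=
  Function.Bijective (fun r : R => r • 𝟙 X)

variable {R}

namespace HasScalarEnd

lemma of_iso {X Y : C} (h : HasScalarEnd R X) (e : X ≅ Y) : HasScalarEnd R Y := by
  have key : (fun r : R => r • 𝟙 Y) = (Linear.homCongr R e e) ∘ fun r : R => r • 𝟙 X := by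
    ext r
    simp [Linear.homCongr]
  unfold HasScalarEnd
  rw [key]
  exact (Linear.homCongr R e e).bijective.comp h

lemma exists_smul {X Y : C} (h : HasScalarEnd R X) (e : X ≅ Y) (f : X ⟶ Y) :
    ∃ r : R, f = r • e.hom := by
  obtain ⟨r, hr⟩ := h.2 (f ≫ e.inv)
  refine ⟨r, ?_⟩
  rw [← cancel_mono e.inv, ← hr]
  simp

lemma smul_iso_injective {X Y : C} (h : HasScalarEnd R X) (e : X ≅ Y) :
    Function.Injective (fun r : R => r • e.hom) := by
  intro r s hrs
  apply h.1
  simpa using congrArg (fun f => f ≫ e.inv) hrs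

lemma id_ne_zero [Nontrivial R] {X : C} (h : HasScalarEnd R X) : 𝟙 X ≠ 0 := by
  intro h0
  exact one_ne_zero (h.1 (by simp [h0]) : (1 : R) = 0)

/-- The only idempotents of a domain are `0` and `1`, so an object whose endomorphisms are scalars
is isomorphic to any of its summands. -/
lemma isIso_of_retract [IsDomain R] {X Y : C} (h : HasScalarEnd R X) (i : Y ⟶ X) (p : X ⟶ Y)
    (hip : i ≫ p = 𝟙 Y) (hY : 𝟙 Y ≠ 0) : Nonempty (X ≅ Y) := by
  obtain ⟨r, hr⟩ := h.2 (p ≫ i)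
  simp only at hr
  have hrr : r * r = r := by
    apply h.1
    have : (p ≫ i) ≫ (p ≫ i) = p ≫ i := by simp [reassoc_of% hip]
    rw [← hr] at this
    simpa [smul_smul] using this
  have hr01 : r = 0 ∨ r = 1 := by
    have : r * (r - 1) = 0 := by rw [mul_sub, hrr]; ring
    rcases mul_eq_zero.mp this with h | h
    · exact Or.inl h
    · exact Or.inr (sub_eq_zero.mp h)
  rcases hr01 with rfl | rfl
  · refine absurd ?_ hY
    have : i ≫ (p ≫ i) ≫ p = 𝟙 Y := by simp [hip]
    rw [← this, ← hr]
    simp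
  · exact ⟨⟨p, i, by simpa using hr.symm, hip⟩⟩

end HasScalarEnd

/-- Over a domain, an object whose endomorphisms are scalars is isomorphic to a simple object. -/
lemma IsSemisimple.exists_iso [IsDomain R] [HasFiniteBiproducts C] {I : Type x} {S : I → C}
    (hS : IsSemisimple R S) {X : C} (hX : HasScalarEnd R X) : ∃ i, Nonempty (X ≅ S i) := by
  obtain ⟨n, d, ⟨e⟩⟩ := hS.decomposition X
  obtain _ | n := n
  · refine absurd ?_ hX.id_ne_zero
    have : 𝟙 (⨁ fun k => S (d k)) = 0 := by
      apply biproduct.hom_ext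
      intro j
      exact j.elim0
    rw [← e.hom_inv_id, ← Category.id_comp e.inv, this]
    simp
  · refine ⟨d 0, hX.isIso_of_retract (biproduct.ι (fun k => S (d k)) 0 ≫ e.inv)
      (e.hom ≫ biproduct.π _ 0) (by simp) ?_⟩
    exact HasScalarEnd.id_ne_zero (hS.end_bijective (d 0))

end Scalar

/-! ### Invertible objects -/

section Invertible

variable {C : Type u} [Category.{v} C] [MonoidalCategory C]

lemma IsInvertible.of_iso {X Y : C} (h : IsInvertible X) (e : X ≅ Y) : IsInvertible Y := by
  obtain ⟨Z, ⟨a⟩, ⟨b⟩⟩ := h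
  exact ⟨Z, ⟨whiskerRightIso e.symm Z ≪≫ a⟩, ⟨whiskerLeftIso Z e.symm ≪≫ b⟩⟩

lemma IsInvertible.symm_inverse {X Y : C} (a : X ⊗ Y ≅ 𝟙_ C) (b : Y ⊗ X ≅ 𝟙_ C) :
    IsInvertible Y :=
  ⟨X, ⟨b⟩, ⟨a⟩⟩

lemma IsInvertible.tensor {X Y : C} (hX : IsInvertible X) (hY : IsInvertible Y) :
    IsInvertible (X ⊗ Y) := by
  obtain ⟨Z, ⟨a⟩, ⟨b⟩⟩ := hX
  obtain ⟨W, ⟨c⟩, ⟨d⟩⟩ := hY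
  refine ⟨W ⊗ Z, ⟨?_⟩, ⟨?_⟩⟩
  · exact α_ X Y (W ⊗ Z) ≪≫ whiskerLeftIso X ((α_ Y W Z).symm ≪≫ whiskerRightIso c Z ≪≫ λ_ Z) ≪≫ a
  · exact α_ W Z (X ⊗ Y) ≪≫ whiskerLeftIso W ((α_ Z X Y).symm ≪≫ whiskerRightIso b Y ≪≫ λ_ Y) ≪≫ d

lemma IsInvertible.isEquivalence_tensorLeft {X : C} (h : IsInvertible X) :
    (tensorLeft X).IsEquivalence := by
  obtain ⟨Y, ⟨a⟩, ⟨b⟩⟩ := h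
  exact (CategoryTheory.Equivalence.mk (tensorLeft X) (tensorLeft Y)
    ((leftUnitorNatIso C).symm ≪≫ (tensoringLeft C).mapIso b.symm ≪≫ tensorLeftTensor Y X)
    ((tensorLeftTensor X Y).symm ≪≫ (tensoringLeft C).mapIso a ≪≫
      leftUnitorNatIso C)).isEquivalence_functor

/-- Tensoring with an invertible object does not change the endomorphism ring. -/
lemma HasScalarEnd.tensorLeft {R : Type w} [CommRing R] [Preadditive C] [Linear R C]
    [MonoidalPreadditive C] [MonoidalLinear R C] {X Y : C} (hY : HasScalarEnd R Y)
    (hX : IsInvertible X) : HasScalarEnd R (X ⊗ Y) := by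
  have := hX.isEquivalence_tensorLeft
  have key : (fun r : R => r • 𝟙 (X ⊗ Y)) =
      (fun f : Y ⟶ Y => (CategoryTheory.MonoidalCategory.tensorLeft X).map f) ∘
        fun r : R => r • 𝟙 Y := by
    ext r
    simp
  unfold HasScalarEnd
  rw [key]
  exact Function.Bijective.comp (Functor.FullyFaithful.map_bijective
    (Functor.FullyFaithful.ofFullyFaithful _) Y Y) hY

end Invertible

/-! ### Splittings into direct sums -/

section Splitting

variable {C : Type u} [Category.{v} C] [Preadditive C]

/-- A splitting of `X` as the direct sum of the finite family `S`, given by the inclusions and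
the projections. -/
structure Splitting {I : Type x} [Fintype I] (S : I → C) (X : C) where
  /-- the inclusion of a summand -/
  incl : ∀ i, S i ⟶ X
  /-- the projection to a summand -/
  proj : ∀ i, X ⟶ S i
  incl_proj : ∀ i, incl i ≫ proj i = 𝟙 (S i)
  incl_proj_ne : ∀ i j, i ≠ j → incl i ≫ proj j = 0
  sum_proj_incl : ∑ i, proj i ≫ incl i = 𝟙 X

/-- The splitting given by an isomorphism with the direct sum. -/
noncomputable def Splitting.ofIso [HasFiniteBiproducts C] {I : Type x} [Fintype I] {S : I → C}
    {X : C} (e : (⨁ S) ≅ X) : Splitting S X where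
  incl i := biproduct.ι S i ≫ e.hom
  proj i := e.inv ≫ biproduct.π S i
  incl_proj i := by simp
  incl_proj_ne i j h := by simp [biproduct.ι_π_ne _ h]
  sum_proj_incl := by
    have : ∑ i, (e.inv ≫ biproduct.π S i) ≫ biproduct.ι S i ≫ e.hom =
        e.inv ≫ (∑ i, biproduct.π S i ≫ biproduct.ι S i) ≫ e.hom := by
      simp [Preadditive.sum_comp, Preadditive.comp_sum]
    have total : ∑ i, biproduct.π S i ≫ biproduct.ι S i = 𝟙 (⨁ S) :=
      IsBilimit.total (biproduct.isBilimit S)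
    rw [this, total]
    simp

lemma Splitting.hom_ext {I : Type x} [Fintype I] {S : I → C} {X Y : C} (s : Splitting S X)
    {f g : Y ⟶ X} (h : ∀ i, f ≫ s.proj i = g ≫ s.proj i) : f = g := by
  rw [← Category.comp_id f, ← Category.comp_id g, ← s.sum_proj_incl, Preadditive.comp_sum,
    Preadditive.comp_sum]
  exact Finset.sum_congr rfl fun i _ => by rw [reassoc_of% (h i)]

lemma Splitting.hom_ext' {I : Type x} [Fintype I] {S : I → C} {X Y : C} (s : Splitting S X)
    {f g : X ⟶ Y} (h : ∀ i, s.incl i ≫ f = s.incl i ≫ g) : f = g := by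
  rw [← Category.id_comp f, ← Category.id_comp g, ← s.sum_proj_incl, Preadditive.sum_comp,
    Preadditive.sum_comp]
  exact Finset.sum_congr rfl fun i _ => by simp [h i]

/-- A splitting into copies of an object `Y` with scalar endomorphisms makes `Hom(Y, X)` a free
module with one basis vector for each summand. -/
noncomputable def Splitting.basis {R : Type w} [CommRing R] [Linear R C] {I : Type x} [Fintype I]
    {S : I → C} {X Y : C} (s : Splitting S X) (hY : HasScalarEnd R Y) (e : ∀ i, Y ≅ S i) :
    Module.Basis I R (Y ⟶ X) :=
  Module.Basis.mk (v := fun i => (e i).hom ≫ s.incl i)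
    (by
      rw [Fintype.linearIndependent_iff]
      intro c hc j
      apply hY.smul_iso_injective (e j)
      have h := congrArg (fun f => f ≫ s.proj j) hc
      simp only [Preadditive.sum_comp, Linear.smul_comp, Category.assoc, zero_comp] at h
      rw [Finset.sum_eq_single j] at h
      · simpa [s.incl_proj] using h
      · intro i _ hij
        simp [s.incl_proj_ne i j hij]
      · simp)
    (by
      intro f _
      choose c hc using fun i => hY.exists_smul (e i) (f ≫ s.proj i)
      have : f = ∑ i, c i • ((e i).hom ≫ s.incl i) := by
        rw [← Category.comp_id f, ← s.sum_proj_incl, Preadditive.comp_sum]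
        exact Finset.sum_congr rfl fun i _ => by
          rw [← Category.assoc, hc, Linear.smul_comp]
      rw [this]
      exact Submodule.sum_mem _ fun i _ =>
        Submodule.smul_mem _ _ (Submodule.subset_span ⟨i, rfl⟩))

lemma Splitting.basis_apply {R : Type w} [CommRing R] [Linear R C] {I : Type x} [Fintype I]
    {S : I → C} {X Y : C} (s : Splitting S X) (hY : HasScalarEnd R Y) (e : ∀ i, Y ≅ S i) (i : I) :
    s.basis hY e i = (e i).hom ≫ s.incl i := by
  simp [Splitting.basis]

variable [MonoidalCategory C] [MonoidalPreadditive C]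

/-- The tensor product distributes over splittings. -/
def Splitting.whiskerRight {I : Type x} [Fintype I] {S : I → C} {X : C} (s : Splitting S X)
    (Y : C) : Splitting (fun i => S i ⊗ Y) (X ⊗ Y) where
  incl i := s.incl i ▷ Y
  proj i := s.proj i ▷ Y
  incl_proj i := by rw [← comp_whiskerRight, s.incl_proj, id_whiskerRight]
  incl_proj_ne i j h := by
    rw [← comp_whiskerRight, s.incl_proj_ne i j h, MonoidalPreadditive.zero_whiskerRight]
  sum_proj_incl := by
    simp_rw [← comp_whiskerRight]
    rw [← sum_whiskerRight, s.sum_proj_incl, id_whiskerRight]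

end Splitting

/-! ### Monodromy -/

section Monodromy

variable {C : Type u} [Category.{v} C] [MonoidalCategory C] [BraidedCategory C]

open BraidedCategory

/-- The double braiding (monodromy) `X ⊗ Y ⟶ Y ⊗ X ⟶ X ⊗ Y`. -/
def monodromy (X Y : C) : X ⊗ Y ⟶ X ⊗ Y :=
  (β_ X Y).hom ≫ (β_ Y X).hom

lemma monodromy_naturality_right (X : C) {Y Z : C} (f : Y ⟶ Z) :
    X ◁ f ≫ monodromy X Z = monodromy X Y ≫ X ◁ f := by
  simp [monodromy]

lemma monodromy_naturality_left {X Y : C} (f : X ⟶ Y) (Z : C) :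
    f ▷ Z ≫ monodromy Y Z = monodromy X Z ≫ f ▷ Z := by
  simp [monodromy]

lemma monodromy_unit (X : C) : monodromy X (𝟙_ C) = 𝟙 _ := by
  simp [monodromy]

variable {R : Type w} [CommRing R] [Preadditive C] [Linear R C] [MonoidalPreadditive C]
  [MonoidalLinear R C]

/-- If `g` has scalar monodromy with `X` and with `Y`, then its monodromy with `X ⊗ Y` is the
product of the two scalars. -/
lemma monodromy_tensor {g X Y : C} {x y : R}
    (hX : monodromy g X = x • 𝟙 _) (hY : monodromy g Y = y • 𝟙 _) :
    monodromy g (X ⊗ Y) = (x * y) • 𝟙 _ := by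
  have key : monodromy g (X ⊗ Y) = (α_ g X Y).inv ≫ (β_ g X).hom ▷ Y ≫ (α_ X g Y).hom ≫
      X ◁ monodromy g Y ≫ (α_ X g Y).inv ≫ (β_ X g).hom ▷ Y ≫ (α_ g X Y).hom := by
    simp [monodromy]
  have key' : (β_ g X).hom ▷ Y ≫ (β_ X g).hom ▷ Y = x • 𝟙 _ := by
    rw [← comp_whiskerRight]
    change monodromy g X ▷ Y = _
    rw [hX, MonoidalLinear.smul_whiskerRight, id_whiskerRight]
  rw [key, hY]
  simp [reassoc_of% key', smul_smul, mul_comm]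

variable {I : Type x} [Fintype I] {S : I → C} {m : C}

/-- If `g` has scalar monodromy `q` with `m`, its monodromy with each summand of `m ⊗ m`
is `q ^ 2`. -/
lemma monodromy_summand (s : Splitting S (m ⊗ m)) {g : C} {q : R}
    (hq : monodromy g m = q • 𝟙 _) (i : I) : monodromy g (S i) = q ^ 2 • 𝟙 _ := by
  have h := monodromy_naturality_right g (s.incl i)
  rw [monodromy_tensor hq hq] at h
  have h' := congrArg (fun f => f ≫ g ◁ s.proj i) h
  simp only [Category.assoc, ← MonoidalCategory.whiskerLeft_comp, s.incl_proj] at h'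
  simpa [← MonoidalCategory.whiskerLeft_comp, s.incl_proj, sq] using h'.symm

end Monodromy

/-! ### Braid operators on `(m ⊗ m) ⊗ m` -/

section BraidOperators

variable {C : Type u} [Category.{v} C] [MonoidalCategory C] [BraidedCategory C]

open BraidedCategory

/-- The braiding of the first two factors of `(m ⊗ m) ⊗ m`. -/
def swapFirst (m : C) : (m ⊗ m) ⊗ m ⟶ (m ⊗ m) ⊗ m :=
  (β_ m m).hom ▷ m

/-- The braiding of the last factor of `(m ⊗ m) ⊗ m` with the first two, brought back to
`(m ⊗ m) ⊗ m` by the associator. -/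
def rotate (m : C) : (m ⊗ m) ⊗ m ⟶ (m ⊗ m) ⊗ m :=
  (β_ (m ⊗ m) m).hom ≫ (α_ m m m).inv

instance (m : C) : IsIso (rotate m) := by
  unfold rotate
  infer_instance

lemma rotate_eq (m : C) :
    rotate m = (α_ m m m).hom ≫ m ◁ (β_ m m).hom ≫ (α_ m m m).inv ≫ swapFirst m := by
  simp [rotate, swapFirst]

lemma swapFirst_rotate (m : C) : swapFirst m ≫ rotate m =
    (β_ (m ⊗ m) m).hom ≫ m ◁ (β_ m m).hom ≫ (α_ m m m).inv := by
  simp only [swapFirst, rotate, ← Category.assoc, braiding_naturality_left]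

/-- The hexagon for `β_ (m ⊗ m) m`, together with the naturality of the braiding. -/
lemma rotate_rotate (m : C) :
    rotate m ≫ rotate m = swapFirst m ≫ rotate m ≫ swapFirst m := by
  rw [← Category.assoc, swapFirst_rotate]
  conv_lhs =>
    arg 2
    rw [rotate_eq m]
  simp [rotate]

/-- The hexagon for `β_ m (m ⊗ m)`, which enters through the monodromy. -/
lemma rotate_swapFirst_rotate (m : C) :
    rotate m ≫ swapFirst m ≫ rotate m = monodromy (m ⊗ m) m ≫ swapFirst m := by
  have h : monodromy (m ⊗ m) m = rotate m ≫ swapFirst m ≫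
      (α_ m m m).hom ≫ m ◁ (β_ m m).hom ≫ (α_ m m m).inv := by
    rw [monodromy, braiding_tensor_right_hom]
    simp [rotate, swapFirst]
  rw [h]
  conv_lhs =>
    arg 2
    arg 2
    rw [rotate_eq]
  simp

lemma swapFirst_monodromy (m : C) :
    swapFirst m ≫ monodromy (m ⊗ m) m = monodromy (m ⊗ m) m ≫ swapFirst m :=
  monodromy_naturality_left _ _

lemma rotate_cube (m : C) :
    rotate m ≫ rotate m ≫ rotate m = swapFirst m ≫ swapFirst m ≫ monodromy (m ⊗ m) m := by
  rw [← Category.assoc, rotate_rotate]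
  simp only [Category.assoc]
  rw [rotate_swapFirst_rotate, swapFirst_monodromy]

end BraidOperators

/-! ### The simple objects of a near-group category and their monodromy -/

section Simple

variable {R : Type w} [CommRing R] {G : Type x} [Group G] [Finite G]
  {C : Type u} [Category.{v} C] [Preadditive C] [Linear R C] [HasFiniteBiproducts C]
  [MonoidalCategory C] {obj : G → C} {m : C}

namespace IsNearGroupCategory

lemma hasScalarEnd_obj (hC : IsNearGroupCategory R obj m) (g : G) : HasScalarEnd R (obj g) :=
  hC.semisimple.end_bijective (some g)

lemma hasScalarEnd_m (hC : IsNearGroupCategory R obj m) : HasScalarEnd R m :=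
  hC.semisimple.end_bijective none

lemma hom_obj_eq_zero (hC : IsNearGroupCategory R obj m) {g h : G} (hgh : g ≠ h)
    (f : obj g ⟶ obj h) : f = 0 :=
  hC.semisimple.hom_eq_zero (some g) (some h) (by simpa using hgh) f

lemma isInvertible_obj (hC : IsNearGroupCategory R obj m) (g : G) : IsInvertible (obj g) := by
  obtain ⟨e⟩ := hC.unit_iso
  obtain ⟨a⟩ := hC.mul_iso g g⁻¹
  obtain ⟨b⟩ := hC.mul_iso g⁻¹ g
  exact ⟨obj g⁻¹, ⟨a.symm ≪≫ eqToIso (by rw [mul_inv_cancel]) ≪≫ e⟩,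
    ⟨b.symm ≪≫ eqToIso (by rw [inv_mul_cancel]) ≪≫ e⟩⟩

variable [MonoidalPreadditive C] [MonoidalLinear R C]

lemma exists_iso_obj [IsDomain R] (hC : IsNearGroupCategory R obj m) {X : C} (hX : IsInvertible X) :
    ∃ g, Nonempty (X ≅ obj g) := by
  obtain ⟨e⟩ := hC.unit_iso
  have h : HasScalarEnd R X :=
    (((hC.hasScalarEnd_obj 1).of_iso e).tensorLeft hX).of_iso (ρ_ X)
  obtain ⟨_ | g, ⟨f⟩⟩ := hC.semisimple.exists_iso h
  · exact absurd (hX.of_iso f) hC.not_invertible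
  · exact ⟨g, ⟨f⟩⟩

lemma groupM_iso [IsDomain R] (hC : IsNearGroupCategory R obj m) (g : G) :
    Nonempty (m ≅ obj g ⊗ m) := by
  have h : HasScalarEnd R (obj g ⊗ m) := hC.hasScalarEnd_m.tensorLeft (hC.isInvertible_obj g)
  obtain ⟨_ | k, ⟨f⟩⟩ := hC.semisimple.exists_iso h
  · exact ⟨f.symm⟩
  · -- otherwise `g ⊗ m` is invertible, and so is `m`
    refine absurd ?_ hC.not_invertible
    obtain ⟨Y, ⟨a⟩, ⟨b⟩⟩ := hC.isInvertible_obj g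
    exact ((IsInvertible.symm_inverse a b).tensor ((hC.isInvertible_obj k).of_iso f.symm)).of_iso
      ((α_ _ _ _).symm ≪≫ whiskerRightIso b m ≪≫ λ_ m)

variable [BraidedCategory C]

/-- The monodromy of `g` with `m` is a sign, and it is trivial on the group objects: by
multiplicativity it is the square of that sign on every summand of `m ⊗ m`, one of which is the
unit object. -/
lemma exists_monodromy (hC : IsNearGroupCategory R obj m) (g : G) :
    ∃ q : R, q ^ 2 = 1 ∧ monodromy (obj g) m = q • 𝟙 _ ∧
      ∀ h, monodromy (obj g) (obj h) = 𝟙 _ := by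
  cases nonempty_fintype G
  obtain ⟨e⟩ := hC.unit_iso
  obtain ⟨F⟩ := hC.fusion
  obtain ⟨q, hq⟩ := (hC.hasScalarEnd_m.tensorLeft (hC.isInvertible_obj g)).2
    (monodromy (obj g) m)
  have hsq := monodromy_summand (Splitting.ofIso F) hq.symm
  have h1 : monodromy (obj g) (obj 1) = 𝟙 _ := by
    rw [← cancel_mono (obj g ◁ e.hom), ← monodromy_naturality_right, monodromy_unit]
    simp
  have hq2 : q ^ 2 = 1 := by
    apply ((hC.hasScalarEnd_obj 1).tensorLeft (hC.isInvertible_obj g)).1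
    simp only [one_smul]
    rw [← hsq 1, h1]
  refine ⟨q, hq2, hq.symm, fun h => ?_⟩
  rw [hsq h, hq2, one_smul]

/-- The braiding is symmetric on sums of invertible objects. -/
lemma monodromy_groupSubcategory [IsDomain R] (hC : IsNearGroupCategory R obj m)
    {X Y : C} (hX : groupSubcategory C X) (hY : groupSubcategory C Y) : monodromy X Y = 𝟙 _ := by
  obtain ⟨k, d, hd, ⟨a⟩⟩ := hX
  obtain ⟨l, d', hd', ⟨b⟩⟩ := hY
  have hsimple : ∀ i j, monodromy (d i) (d' j) = 𝟙 _ := by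
    intro i j
    obtain ⟨g, ⟨f⟩⟩ := hC.exists_iso_obj (hd i)
    obtain ⟨h, ⟨f'⟩⟩ := hC.exists_iso_obj (hd' j)
    obtain ⟨-, -, -, hgh⟩ := hC.exists_monodromy g
    rw [← cancel_mono (d i ◁ f'.hom), ← monodromy_naturality_right,
      ← cancel_mono (f.hom ▷ obj h), Category.assoc, ← monodromy_naturality_left, hgh]
    simp
  have hleft : ∀ i, monodromy (d i) Y = 𝟙 _ := by
    intro i
    let s' := Splitting.ofIso b.symm
    have hd : ∀ j, d i ◁ s'.incl j ≫ monodromy (d i) Y = d i ◁ s'.incl j := fun j => by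
      rw [monodromy_naturality_right, hsimple, Category.id_comp]
    rw [← Category.id_comp (monodromy (d i) Y), ← MonoidalCategory.whiskerLeft_id,
      ← s'.sum_proj_incl, whiskerLeft_sum, Preadditive.sum_comp]
    exact Finset.sum_congr rfl fun j _ => by
      rw [MonoidalCategory.whiskerLeft_comp, Category.assoc, hd]
  let s := Splitting.ofIso a.symm
  refine (s.whiskerRight Y).hom_ext' fun i => ?_
  change s.incl i ▷ Y ≫ _ = s.incl i ▷ Y ≫ _
  rw [monodromy_naturality_left, hleft]
  simp

end IsNearGroupCategory

end Simple

/-! ### Coefficients of the associator of `m` -/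

section Coefficients

variable {R : Type w} [CommRing R] {G : Type x} [Group G] [Fintype G]
  {C : Type u} [Category.{v} C] [Preadditive C] [Linear R C] [HasFiniteBiproducts C]
  [MonoidalCategory C] {obj : G → C} {m : C}

namespace IsNearGroupCategory

/-- A retraction of `m ⊗ m` onto the summand `g` is a multiple of the projection by a unit. -/
lemma exists_proj_eq_smul (hC : IsNearGroupCategory R obj m) (s : Splitting obj (m ⊗ m)) {g : G}
    (i : obj g ⟶ m ⊗ m) (p : m ⊗ m ⟶ obj g) (hip : i ≫ p = 𝟙 _) :
    ∃ t : R, s.proj g = t • p := by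
  obtain ⟨c, hc⟩ := (hC.hasScalarEnd_obj g).2 (s.incl g ≫ p)
  obtain ⟨t, ht⟩ := (hC.hasScalarEnd_obj g).2 (i ≫ s.proj g)
  simp only at hc ht
  have hp : p = c • s.proj g := by
    refine s.hom_ext' fun k => ?_
    by_cases hk : k = g
    · subst hk
      rw [← hc, Linear.comp_smul, s.incl_proj]
    · rw [hC.hom_obj_eq_zero hk (s.incl k ≫ p), hC.hom_obj_eq_zero hk (s.incl k ≫ _)]
  have htc : c * t = 1 := by
    apply (hC.hasScalarEnd_obj g).1
    simp only
    rw [mul_smul, ht, ← Linear.comp_smul, ← hp, hip, one_smul]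
  refine ⟨t, ?_⟩
  rw [hp, smul_smul, mul_comm, htc, one_smul]

variable [MonoidalPreadditive C] [MonoidalLinear R C]

/-- Translation by `g`: the coefficient of the coevaluation-like morphism
`m ⊗ 1 ⟶ m ⊗ (m ⊗ m) ⟶ (m ⊗ m) ⊗ m` at the summand `g * h` vanishes as soon as the one at `h`
does. If the first factor `m` is written as `g ⊗ m`, then by the pentagon the former is, up to a unit,
`g` tensored with the latter. -/
lemma coeff_translate (hC : IsNearGroupCategory R obj m) [IsDomain R]
    (s : Splitting obj (m ⊗ m)) {X : C} (j : X ⟶ m ⊗ m) {g h : G}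
    (h0 : m ◁ j ≫ (α_ m m m).inv ≫ s.proj h ▷ m = 0) :
    m ◁ j ≫ (α_ m m m).inv ≫ s.proj (g * h) ▷ m = 0 := by
  obtain ⟨e⟩ := hC.groupM_iso g
  obtain ⟨f⟩ := hC.mul_iso g h
  obtain ⟨t, ht⟩ := hC.exists_proj_eq_smul s
    (f.hom ≫ obj g ◁ s.incl h ≫ (α_ _ _ _).inv ≫ e.inv ▷ m)
    (e.hom ▷ m ≫ (α_ _ _ _).hom ≫ obj g ◁ s.proj h ≫ f.inv)
    (by
      have h1 : e.inv ▷ m ≫ e.hom ▷ m = 𝟙 _ := by simp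
      have h2 : obj g ◁ s.incl h ≫ obj g ◁ s.proj h = 𝟙 _ := by
        rw [← MonoidalCategory.whiskerLeft_comp, s.incl_proj, MonoidalCategory.whiskerLeft_id]
      simp [reassoc_of% h1, reassoc_of% h2])
  have key : m ◁ j ≫ (α_ m m m).inv ≫ ((e.hom ▷ m ≫ (α_ _ _ _).hom ≫ obj g ◁ s.proj h) ▷ m) =
      e.hom ▷ X ≫ (α_ _ _ _).hom ≫
        obj g ◁ (m ◁ j ≫ (α_ m m m).inv ≫ s.proj h ▷ m) ≫ (α_ _ _ _).inv := by
    have hex : m ◁ j ≫ e.hom ▷ (m ⊗ m) = e.hom ▷ X ≫ (obj g ⊗ m) ◁ j := whisker_exchange _ _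
    have hα : (α_ m m m).inv ≫ e.hom ▷ m ▷ m = e.hom ▷ (m ⊗ m) ≫ (α_ (obj g ⊗ m) m m).inv := by
      simp
    rw [comp_whiskerRight, reassoc_of% hα, reassoc_of% hex]
    monoidal
  have hcomp : e.hom ▷ m ≫ (α_ _ _ _).hom ≫ obj g ◁ s.proj h ≫ f.inv =
      (e.hom ▷ m ≫ (α_ _ _ _).hom ≫ obj g ◁ s.proj h) ≫ f.inv := by simp
  rw [ht, MonoidalLinear.smul_whiskerRight, hcomp, comp_whiskerRight, Linear.comp_smul,
    Linear.comp_smul, reassoc_of% key, h0]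
  simp

/-- No coefficient of `m ⊗ 1 ⟶ m ⊗ (m ⊗ m) ⟶ (m ⊗ m) ⊗ m` vanishes. -/
lemma coeff_ne_zero (hC : IsNearGroupCategory R obj m) [IsDomain R]
    (s : Splitting obj (m ⊗ m)) (g : G) :
    m ◁ s.incl 1 ≫ (α_ m m m).inv ≫ s.proj g ▷ m ≠ 0 := by
  intro h0
  have hall : m ◁ s.incl 1 ≫ (α_ m m m).inv = 0 := by
    refine (s.whiskerRight m).hom_ext fun k => ?_
    have := hC.coeff_translate s (s.incl 1) (g := k * g⁻¹) h0
    rw [inv_mul_cancel_right] at this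
    simpa [Splitting.whiskerRight] using this
  have h1 : m ◁ s.incl 1 = 0 := by
    rw [← cancel_mono (α_ m m m).inv, hall, zero_comp]
  have h2 : 𝟙 (m ⊗ obj 1) = 0 := by
    rw [← MonoidalCategory.whiskerLeft_id, ← s.incl_proj, MonoidalCategory.whiskerLeft_comp, h1,
      zero_comp]
  obtain ⟨e⟩ := hC.unit_iso
  exact (hC.hasScalarEnd_m.of_iso ((ρ_ m).symm ≪≫ whiskerLeftIso m e.symm)).id_ne_zero h2

end IsNearGroupCategory

end Coefficients

/-! ### The twists are roots of unity -/

section RootsOfUnity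

lemma det_eq_prod_of_apply_basis {R : Type w} [CommRing R] {I : Type x} [Fintype I] {V : Type v}
    [AddCommGroup V] [Module R V] (b : Module.Basis I R V) (f : V →ₗ[R] V) (c : I → R)
    (h : ∀ i, f (b i) = c i • b i) : LinearMap.det f = ∏ i, c i := by
  classical
  rw [← LinearMap.det_toMatrix b]
  have : LinearMap.toMatrix b b f = Matrix.diagonal c := by
    ext i j
    by_cases hij : i = j
    · subst hij
      simp [LinearMap.toMatrix_apply, h]
    · simp [LinearMap.toMatrix_apply, h, Matrix.diagonal_apply_ne _ hij,
        Finsupp.single_eq_of_ne hij]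
  rw [this, Matrix.det_diagonal]

variable {R : Type w} [CommRing R] {G : Type x} [Group G] [Fintype G]
  {C : Type u} [Category.{v} C] [Preadditive C] [Linear R C] [HasFiniteBiproducts C]
  [MonoidalCategory C] [BraidedCategory C]
  {obj : G → C} {m : C}

namespace IsNearGroupCategory

lemma exists_twist (hC : IsNearGroupCategory R obj m) (s : Splitting obj (m ⊗ m)) (g : G) :
    ∃ c : R, s.incl g ≫ (β_ m m).hom = c • s.incl g := by
  obtain ⟨c, hc⟩ := (hC.hasScalarEnd_obj g).2 (s.incl g ≫ (β_ m m).hom ≫ s.proj g)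
  refine ⟨c, s.hom_ext fun k => ?_⟩
  by_cases hk : g = k
  · subst hk
    rw [Linear.smul_comp, s.incl_proj, Category.assoc]
    exact hc.symm
  · rw [hC.hom_obj_eq_zero hk (_ ≫ s.proj k), hC.hom_obj_eq_zero hk (_ ≫ s.proj k)]

variable [IsDomain R] [MonoidalPreadditive C] [MonoidalLinear R C] {σ q : G → R}

/-- The determinants of the braid operators on `Hom(m, (m ⊗ m) ⊗ m)`: with `b` the rotation, `d`
the braiding of the first two factors and `k` the monodromy of `m ⊗ m` with `m`, the relations
`b ^ 2 = d b d` and `b ^ 3 = d ^ 2 k` give `det b = (det d) ^ 2` and `(det d) ^ 4 = det k`. -/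
lemma prod_twist_pow (hC : IsNearGroupCategory R obj m) (s : Splitting obj (m ⊗ m))
    (hσ : ∀ g, s.incl g ≫ (β_ m m).hom = σ g • s.incl g)
    (hq : ∀ g, monodromy (obj g) m = q g • 𝟙 _) (hq2 : ∀ g, q g ^ 2 = 1) :
    (∏ g, σ g) ^ 8 = 1 := by
  let e := (s.whiskerRight m).basis hC.hasScalarEnd_m fun g => (hC.groupM_iso g).some
  have he : ∀ g, e g = (hC.groupM_iso g).some.hom ≫ s.incl g ▷ m :=
    (s.whiskerRight m).basis_apply _ _
  let d := Linear.rightComp R m (swapFirst m)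
  let b := Linear.rightComp R m (rotate m)
  let b' := Linear.rightComp R m (inv (rotate m))
  let k := Linear.rightComp R m (monodromy (m ⊗ m) m)
  have hd : LinearMap.det d = ∏ g, σ g := by
    refine det_eq_prod_of_apply_basis e d σ fun g => ?_
    have : s.incl g ▷ m ≫ swapFirst m = σ g • s.incl g ▷ m := by
      rw [swapFirst, ← comp_whiskerRight, hσ, MonoidalLinear.smul_whiskerRight]
    change e g ≫ swapFirst m = _
    rw [he, Category.assoc, this, Linear.comp_smul]
  have hk : LinearMap.det k = ∏ g, q g := by
    refine det_eq_prod_of_apply_basis e k q fun g => ?_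
    change e g ≫ monodromy (m ⊗ m) m = _
    rw [he, Category.assoc, monodromy_naturality_left, hq]
    simp
  have hb2 : b * b = d * b * d := by
    ext f
    change (f ≫ rotate m) ≫ rotate m = ((f ≫ swapFirst m) ≫ rotate m) ≫ swapFirst m
    simp only [Category.assoc, rotate_rotate]
  have hb3 : b * b * b = k * d * d := by
    ext f
    change ((f ≫ rotate m) ≫ rotate m) ≫ rotate m =
      ((f ≫ swapFirst m) ≫ swapFirst m) ≫ monodromy (m ⊗ m) m
    simp only [Category.assoc, rotate_cube]
  have hbb : b * b' = 1 := by
    ext f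
    change (f ≫ inv (rotate m)) ≫ rotate m = f
    simp
  replace hb2 := congrArg LinearMap.det hb2
  replace hb3 := congrArg LinearMap.det hb3
  replace hbb := congrArg LinearMap.det hbb
  simp only [map_mul, map_one, hd, hk] at hb2 hb3 hbb
  set D := ∏ g, σ g
  set K := ∏ g, q g
  set B := LinearMap.det b
  have hB0 : B ≠ 0 := left_ne_zero_of_mul_eq_one hbb
  have hBD : B = D ^ 2 := mul_left_cancel₀ hB0 (by linear_combination hb2)
  have hD0 : D ≠ 0 := by
    intro h
    exact hB0 (by rw [hBD, h]; ring)
  have hDK : D ^ 4 = K := by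
    apply mul_left_cancel₀ (pow_ne_zero 2 hD0)
    rw [hBD] at hb3
    linear_combination hb3
  have hK : K ^ 2 = 1 := by
    rw [← Finset.prod_pow]
    simp [hq2]
  rw [← hK, ← hDK]
  ring

/-- Since the rotation commutes with the diagonal operator with eigenvalues `σ g ^ 2 * q g` and
none of its matrix coefficients in the column of `1` vanishes, these eigenvalues are all equal. -/
lemma twist_sq_mul (hC : IsNearGroupCategory R obj m) (s : Splitting obj (m ⊗ m))
    (hσ : ∀ g, s.incl g ≫ (β_ m m).hom = σ g • s.incl g)
    (hq : ∀ g, monodromy (obj g) m = q g • 𝟙 _) (g : G) :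
    σ g ^ 2 * q g = σ 1 ^ 2 * q 1 := by
  have hσ' : ∀ g, (β_ m m).hom ≫ s.proj g = σ g • s.proj g := by
    refine fun g => s.hom_ext' fun k => ?_
    rw [← Category.assoc, hσ, Linear.smul_comp, Linear.comp_smul]
    by_cases hk : k = g
    · rw [hk]
    · rw [s.incl_proj_ne k g hk, smul_zero, smul_zero]
  set D := swapFirst m ≫ swapFirst m ≫ monodromy (m ⊗ m) m with hD
  have hcomm : rotate m ≫ D = D ≫ rotate m := by
    rw [hD, ← rotate_cube]
    simp only [Category.assoc]
  have hincl : s.incl 1 ▷ m ≫ D = (σ 1 ^ 2 * q 1) • s.incl 1 ▷ m := by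
    have : s.incl 1 ▷ m ≫ swapFirst m = σ 1 • s.incl 1 ▷ m := by
      rw [swapFirst, ← comp_whiskerRight, hσ, MonoidalLinear.smul_whiskerRight]
    rw [hD, reassoc_of% this, Linear.smul_comp, reassoc_of% this, Linear.smul_comp,
      monodromy_naturality_left, hq]
    simp [smul_smul]
    ring_nf
  have hproj : D ≫ s.proj g ▷ m = (σ g ^ 2 * q g) • s.proj g ▷ m := by
    have : swapFirst m ≫ s.proj g ▷ m = σ g • s.proj g ▷ m := by
      rw [swapFirst, ← comp_whiskerRight, hσ', MonoidalLinear.smul_whiskerRight]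
    rw [hD, Category.assoc, Category.assoc, ← monodromy_naturality_left, hq]
    simp [this, smul_smul]
    ring_nf
  set w := s.incl 1 ▷ m ≫ rotate m ≫ s.proj g ▷ m with hw
  have hw_eq : w = (β_ (obj 1) m).hom ≫ m ◁ s.incl 1 ≫ (α_ m m m).inv ≫ s.proj g ▷ m := by
    simp only [hw, rotate, Category.assoc, BraidedCategory.braiding_naturality_left_assoc]
  have hw0 : w ≠ 0 := by
    intro h
    refine hC.coeff_ne_zero s g ?_
    rw [← cancel_epi (β_ (obj 1) m).hom, ← hw_eq, h, comp_zero]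
  have hκ : (σ g ^ 2 * q g) • w = (σ 1 ^ 2 * q 1) • w := by
    rw [hw, ← Linear.comp_smul, ← Linear.comp_smul, ← hproj, reassoc_of% hcomm,
      reassoc_of% hincl, Linear.smul_comp]
  obtain ⟨e1⟩ := hC.groupM_iso 1
  obtain ⟨eg⟩ := hC.groupM_iso g
  obtain ⟨r, hr⟩ := (hC.hasScalarEnd_m.of_iso e1).exists_smul (e1.symm ≪≫ eg) w
  have hr0 : r ≠ 0 := by
    rintro rfl
    exact hw0 (by simpa using hr)
  rw [hr, smul_smul, smul_smul] at hκ
  exact mul_right_cancel₀ hr0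
    ((hC.hasScalarEnd_m.of_iso e1).smul_iso_injective (e1.symm ≪≫ eg) hκ)

/-- The twists `σ g` have a common fourth power, so the eighth power of their product is
`σ g ^ (8 * |G|)`. -/
lemma twist_pow (hC : IsNearGroupCategory R obj m) (s : Splitting obj (m ⊗ m))
    (hσ : ∀ g, s.incl g ≫ (β_ m m).hom = σ g • s.incl g)
    (hq : ∀ g, monodromy (obj g) m = q g • 𝟙 _) (hq2 : ∀ g, q g ^ 2 = 1) (g : G) :
    σ g ^ (8 * Nat.card G) = 1 := by
  have h4 : ∀ k, σ k ^ 4 = σ 1 ^ 4 := fun k => by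
    linear_combination (σ k ^ 2 * q k + σ 1 ^ 2 * q 1) * hC.twist_sq_mul s hσ hq k
      - σ k ^ 4 * hq2 k + σ 1 ^ 4 * hq2 1
  have h8 : ∀ k, σ k ^ 8 = σ g ^ 8 := fun k => by
    linear_combination (σ k ^ 4 + σ g ^ 4) * (h4 k - h4 g)
  rw [← hC.prod_twist_pow s hσ hq hq2, ← Finset.prod_pow, Finset.prod_congr rfl fun k _ => h8 k,
    Finset.prod_const, Finset.card_univ, ← Nat.card_eq_fintype_card, pow_mul]

end IsNearGroupCategory

end RootsOfUnity

/-! ### Choice of the isomorphisms between group objects -/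

section Basis

variable {R : Type w} [CommRing R] {G : Type x} [CommGroup G] [Finite G]
  {C : Type u} [Category.{v} C] [Preadditive C] [Linear R C] [HasFiniteBiproducts C]
  [MonoidalCategory C] [BraidedCategory C] {obj : G → C} {m : C}

/-- Isomorphisms `gh ⟶ g ⊗ h` can be chosen so that every braiding of two group objects becomes
a sign: for `g < h` in some linear order of `G`, let the braiding carry the isomorphism for
`(g, h)` to the one for `(h, g)`. -/
lemma IsNearGroupCategory.exists_groupGroup (hC : IsNearGroupCategory R obj m)
    (hmon : ∀ g h, monodromy (obj g) (obj h) = 𝟙 _) :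
    ∃ (φ : ∀ g h : G, obj (g * h) ≅ obj g ⊗ obj h) (σ : G → G → R),
      (∀ g h, (φ g h).hom ≫ (β_ (obj g) (obj h)).hom =
        σ g h • (eqToHom (congrArg obj (mul_comm g h)) ≫ (φ h g).hom)) ∧
      ∀ g h, σ g h ^ 2 = 1 := by
  classical
  let _ : LinearOrder G := linearOrderOfSTO WellOrderingRel
  let ψ := fun g h => (hC.mul_iso g h).some
  have hself : ∀ g, ∃ c : R, c ^ 2 = 1 ∧
      (ψ g g).hom ≫ (β_ (obj g) (obj g)).hom = c • (ψ g g).hom := by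
    intro g
    obtain ⟨c, hc⟩ := (hC.hasScalarEnd_obj (g * g)).exists_smul (ψ g g)
      ((ψ g g).hom ≫ (β_ (obj g) (obj g)).hom)
    refine ⟨c, ?_, hc⟩
    apply (hC.hasScalarEnd_obj (g * g)).smul_iso_injective (ψ g g)
    have h := congrArg (fun f => (ψ g g).hom ≫ f) (hmon g g)
    simp only [monodromy, Category.comp_id] at h
    rw [← Category.assoc, hc, Linear.smul_comp, hc, smul_smul] at h
    simpa [sq] using h
  choose c hc hcβ using hself
  let φ : ∀ g h : G, obj (g * h) ≅ obj g ⊗ obj h := fun g h =>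
    if g ≤ h then ψ g h else eqToIso (congrArg obj (mul_comm g h)) ≪≫ ψ h g ≪≫ β_ _ _
  refine ⟨φ, fun g h => if g = h then c g else 1, fun g h => ?_, fun g h => ?_⟩
  · rcases lt_trichotomy g h with hgh | rfl | hgh
    · simp [φ, hgh.le, hgh.not_ge, hgh.ne]
    · simpa [φ] using hcβ g
    · have := hmon h g
      rw [monodromy] at this
      simp [φ, hgh.le, hgh.not_ge, hgh.ne', this]
  · dsimp only
    split_ifs
    · exact hc g
    · exact one_pow 2

end Basis

end NearGroup

theorem corollary1p3 {R : Type w} [CommRing R] [IsDomain R] {G : Type x} [CommGroup G] [Finite G]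
    {C : Type u} [Category.{v} C] [Preadditive C] [Linear R C] [HasFiniteBiproducts C]
    [MonoidalCategory C] [MonoidalPreadditive C] [MonoidalLinear R C]
    (obj : G → C) (m : C) (hC : NearGroup.IsNearGroupCategory R obj m)
    (hR : ∃ ζ : R, IsPrimitiveRoot ζ (8 * Nat.card G))
    [BraidedCategory C] :
    (∀ X Y : C, NearGroup.groupSubcategory C X → NearGroup.groupSubcategory C Y →
      (β_ X Y).hom ≫ (β_ Y X).hom = 𝟙 (X ⊗ Y)) ∧
    ∃ (B : NearGroup.ProductBasis obj m) (σ₀ : G → G → R) (σ₁ σ₂ σ₃ : G → R),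
      B.IsCommutativity σ₀ σ₁ σ₂ σ₃ ∧
      (∀ g h : G, σ₀ g h ^ (8 * Nat.card G) = 1) ∧
      (∀ g : G, σ₁ g ^ (8 * Nat.card G) = 1) ∧
      (∀ g : G, σ₂ g ^ (8 * Nat.card G) = 1) ∧
      (∀ g : G, σ₃ g ^ (8 * Nat.card G) = 1) := by
  cases nonempty_fintype G
  choose q hq2 hqm hqg using fun g => hC.exists_monodromy g
  refine ⟨fun X Y hX hY => hC.monodromy_groupSubcategory hX hY, ?_⟩
  obtain ⟨φ, σ₀, hφ, hσ₀⟩ := hC.exists_groupGroup hqg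
  let u := fun g => (hC.groupM_iso g).some
  obtain ⟨F⟩ := hC.fusion
  let s := NearGroup.Splitting.ofIso F
  choose σ₃ hσ₃ using hC.exists_twist s
  have hdvd : 2 ∣ 8 * Nat.card G := ⟨4 * Nat.card G, by ring⟩
  have hsign : ∀ r : R, r ^ 2 = 1 → r ^ (8 * Nat.card G) = 1 := by
    rintro r hr
    obtain ⟨k, hk⟩ := hdvd
    rw [hk, pow_mul, hr, one_pow]
  -- the bases of `Hom(m, m ⊗ g)` are transported along the braiding, so that `σ₁ = 1` and `σ₂`
  -- is the monodromy
  refine ⟨⟨φ, u, fun g => u g ≪≫ β_ (obj g) m, F⟩, σ₀, fun _ => 1, q, σ₃,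
    ⟨hφ, fun g => by simp, fun g => ?_, fun g => hσ₃ g⟩, fun g h => hsign _ (hσ₀ g h),
    fun g => one_pow _, fun g => hsign _ (hq2 g), hC.twist_pow s hσ₃ hqm hq2⟩
  have h := hqm g
  rw [NearGroup.monodromy] at h
  simp [h]
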